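/- Let $n\ge 0$ and let $A$ be an $n\times n$ matrix with nonnegative real entries. Consider two algebras on $\mathbb R_{\ge0}$: nonnegative algebra, with the usual addition and multiplication, and max algebra, with $a\oplus b=\max(a,b)$ as addition and the usual multiplication. In each algebra, let $A^k$ denote the $k$-th power of $A$ computed in that algebra; for a nonnegative matrix $B$ and $\rho\ge0$ let $V(B,\rho)=\{x\in\mathbb R_{\ge0}^n : Bx=\rho x\}$, where the product $Bx$ is taken in that algebra; let $\Lambda(B)$ be the set of all $\rho>0$ with $V(B,\rho)\ne\{0\}$; and let $V^\Sigma(B)=\sum_{\rho\in\Lambda(B)}V(B,\rho)$ be the set of all finite sums, in that algebra, of vectors of these eigencones ($V^\Sigma(B)=\{0\}$ if $\Lambda(B)=\emptyset$). An extremal of a cone $V$ is a nonzero $z\in V$ such that, whenever $z=u+v$ with $u,v\in V$, both $u$ and $v$ are nonnegative multiples of $z$ (nonnegative algebra), respectively such that, whenever $z=u\oplus v$ with $u,v\in V$, $z=u$ or $z=v$ (max algebra). Then, in both algebras, for each integer $k\ge1$, $$\{\text{extremals of }V^\Sigma(A^k)\}=\bigcup_{\rho\in\Lambda(A)}\{\text{extremals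 of }V(A^k,\rho^k)\}.$$ -/

import Mathlib

open scoped NNReal Matrix

/-- The max algebra: nonnegative reals with `a ⊕ b = max a b` as addition and the usual
multiplication. -/
def MaxAlg : Type := ℝ≥0

/-- A nonnegative real, seen as an element of the max algebra. -/
def toMax : ℝ≥0 ≃ MaxAlg := Equiv.refl _

noncomputable instance : Add MaxAlg := ⟨fun a b => toMax (max (toMax.symm a) (toMax.symm b))⟩

noncomputable instance : Mul MaxAlg := ⟨fun a b => toMax (toMax.symm a * toMax.symm b)⟩

noncomputable instance : Zero MaxAlg := ⟨toMax 0⟩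

noncomputable instance : One MaxAlg := ⟨toMax 1⟩

/-- The semiring structure of the max algebra: addition is the maximum, multiplication is the
usual one, and the neutral elements are the usual `0` and `1`. Over this semiring, Mathlib's matrix
product, matrix power, `*ᵥ`, and submodules are max-algebraic matrix product, max-algebraic power,
max-algebraic matrix-vector product, and max cones. -/
noncomputable instance : CommSemiring MaxAlg where
  add_assoc a b c := max_assoc (α := ℝ≥0) a b c
  zero_add a := max_eq_right (α := ℝ≥0) (zero_le (a := toMax.symm a))
  add_zero a := max_eq_left (α := ℝ≥0) (zero_le (a := toMax.symm a))
  add_comm a b := max_comm (α := ℝ≥0) a b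
  left_distrib a b c := mul_max_of_nonneg (R := ℝ≥0) b c (zero_le (a := toMax.symm a))
  right_distrib a b c := max_mul_of_nonneg (R := ℝ≥0) a b (zero_le (a := toMax.symm c))
  zero_mul a := zero_mul (M₀ := ℝ≥0) a
  mul_zero a := mul_zero (M₀ := ℝ≥0) a
  mul_assoc a b c := mul_assoc (G := ℝ≥0) a b c
  one_mul a := one_mul (M := ℝ≥0) a
  mul_one a := mul_one (M := ℝ≥0) a
  mul_comm a b := mul_comm (G := ℝ≥0) a b
  nsmul := nsmulRec

theorem toMax_add (a b : ℝ≥0) : toMax a + toMax b = toMax (max a b) := rfl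

theorem toMax_mul (a b : ℝ≥0) : toMax a * toMax b = toMax (a * b) := rfl

theorem toMax_zero : toMax 0 = 0 := rfl

theorem toMax_one : toMax 1 = 1 := rfl

/-- The eigencone `V(A, ρ)`: all `x` with `A x = ρ x` (including `x = 0`). For `R = ℝ≥0` this is
the eigencone in nonnegative algebra, for `R = MaxAlg` the one in max algebra. -/
def eigencone {R : Type} [CommSemiring R] {n : ℕ} (A : Matrix (Fin n) (Fin n) R) (ρ : R) :
    Submodule R (Fin n → R) where
  carrier := {x | A *ᵥ x = ρ • x}
  add_mem' := by
    intro x y (hx : A *ᵥ x = ρ • x) (hy : A *ᵥ y = ρ • y)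
    change A *ᵥ (x + y) = ρ • (x + y)
    rw [Matrix.mulVec_add, hx, hy, smul_add]
  zero_mem' := by
    change A *ᵥ 0 = ρ • 0
    rw [Matrix.mulVec_zero, smul_zero]
  smul_mem' := by
    intro c x (hx : A *ᵥ x = ρ • x)
    change A *ᵥ (c • x) = ρ • (c • x)
    rw [Matrix.mulVec_smul, hx, smul_comm]

/-- `Λ(A)`: the set of nonzero eigenvalues of `A`, that is, of the scalars `ρ ≠ 0` for which some
nonzero vector `x` over the semiring satisfies `A x = ρ x`. -/
def nonzeroEigenvalues {R : Type} [CommSemiring R] {n : ℕ} (A : Matrix (Fin n) (Fin n) R) :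
    Set R :=
  {ρ | ρ ≠ 0 ∧ ∃ x : Fin n → R, x ≠ 0 ∧ x ∈ eigencone A ρ}

/-- `V^Σ(A)`: the sum of the eigencones `V(A, ρ)` over `ρ ∈ Λ(A)`; it is `{0}` when `Λ(A)` is
empty. (The supremum of submodules consists of all finite sums of their elements.) -/
def eigenconeSum {R : Type} [CommSemiring R] {n : ℕ} (A : Matrix (Fin n) (Fin n) R) :
    Submodule R (Fin n → R) :=
  ⨆ ρ ∈ nonzeroEigenvalues A, eigencone A ρ

/-- The extremals of a convex cone in the nonnegative orthant: the nonzero vectors `z` of the cone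
such that in each decomposition `z = u + v` inside the cone both `u` and `v` are multiples
of `z`. -/
def extremalsNonneg {n : ℕ} (V : Submodule ℝ≥0 (Fin n → ℝ≥0)) : Set (Fin n → ℝ≥0) :=
  {z | z ∈ V ∧ z ≠ 0 ∧
    ∀ u ∈ V, ∀ v ∈ V, z = u + v → (∃ α : ℝ≥0, u = α • z) ∧ (∃ β : ℝ≥0, v = β • z)}

/-- The extremals of a max cone: the nonzero vectors `z` of the cone such that `z = u ⊕ v` inside
the cone forces `z = u` or `z = v`. -/
def extremalsMax {n : ℕ} (V : Submodule MaxAlg (Fin n → MaxAlg)) : Set (Fin n → MaxAlg) :=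
  {z | z ∈ V ∧ z ≠ 0 ∧ ∀ u ∈ V, ∀ v ∈ V, z = u + v → z = u ∨ z = v}

/-! Two facts combine. First, the nonzero eigenvalues of `A ^ k` are the `ρ ^ k` with `ρ` one of
`A`: roots exist, and averaging a vector over powers of `A` turns an eigenvector of `A ^ k` into one
of `A`, nonzero because nothing cancels (`nonzeroEigenvalues_pow`).

Second, for every `B`, the extremals of the sum of eigencones are those of the single eigencones. An
extremal of the sum must already lie in one summand. Conversely, if a `μ`-eigenvector is a sum of
eigenvectors, applying `B ^ t` for all `t` compares exponential sums in each coordinate, so it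
equals its own `μ`-component (`ExpSumCoeffUnique`). A splitting inside the sum thus induces one
inside the eigencone; the remaining components vanish in nonnegative algebra and are absorbed in max
algebra. -/

section General

variable {R : Type} [CommSemiring R] {n : ℕ}

theorem mem_eigencone {B : Matrix (Fin n) (Fin n) R} {ρ : R} {x : Fin n → R} :
    x ∈ eigencone B ρ ↔ B *ᵥ x = ρ • x := Iff.rfl

theorem eigencone_le_eigencone_pow (A : Matrix (Fin n) (Fin n) R) (ρ : R) (k : ℕ) :
    eigencone A ρ ≤ eigencone (A ^ k) (ρ ^ k) := by
  intro x hx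
  rw [mem_eigencone] at hx ⊢
  induction k with
  | zero => simp
  | succ k ih =>
    rw [pow_succ, ← Matrix.mulVec_mulVec, hx, Matrix.mulVec_smul, ih, smul_smul, pow_succ']

/-- If `A ^ k` scales `x` by `ρ ^ k`, then the sum of the vectors `ρ ^ (k - 1 - i) A ^ i x` is
scaled by `ρ` under `A`. -/
theorem sum_pow_mulVec_mem_eigencone (A : Matrix (Fin n) (Fin n) R) (ρ : R) (k : ℕ)
    {x : Fin n → R} (hx : x ∈ eigencone (A ^ (k + 1)) (ρ ^ (k + 1))) :
    ∑ i ∈ Finset.range (k + 1), ρ ^ (k - i) • (A ^ i *ᵥ x) ∈ eigencone A ρ := by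
  rw [mem_eigencone] at hx ⊢
  -- `A` shifts the index by one: the last term on the left, `A ^ (k + 1) *ᵥ x`, wraps around to `ρ`
  -- times the term `i = 0` on the right.
  rw [Matrix.mulVec_sum, Finset.sum_range_succ, Finset.sum_range_succ', smul_add, Finset.smul_sum]
  simp only [Matrix.mulVec_smul, Matrix.mulVec_mulVec, ← pow_succ', hx, smul_smul, Nat.sub_self,
    pow_zero, one_smul, Nat.sub_zero, Matrix.one_mulVec]
  congr 1
  refine Finset.sum_congr rfl fun i hi => ?_
  rw [show k - (i + 1) + 1 = k - i by have := Finset.mem_range.1 hi; omega]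

theorem nonzeroEigenvalues_pow [NoZeroDivisors R] (hadd : ∀ a b : R, a + b = 0 → a = 0)
    (k : ℕ) (hroot : ∀ μ : R, ∃ ρ, ρ ^ (k + 1) = μ) (A : Matrix (Fin n) (Fin n) R) :
    nonzeroEigenvalues (A ^ (k + 1)) = (fun ρ => ρ ^ (k + 1)) '' nonzeroEigenvalues A := by
  ext μ
  constructor
  · rintro ⟨hμ, x, hx0, hx⟩
    obtain ⟨ρ, rfl⟩ := hroot μ
    have hρ : ρ ≠ 0 := fun h => hμ (by rw [h, zero_pow k.succ_ne_zero])
    refine ⟨ρ, ⟨hρ, _, ?_, sum_pow_mulVec_mem_eigencone A ρ k hx⟩, rfl⟩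
    intro h
    apply hx0
    -- The term `i = 0` is `ρ ^ k • x`; without cancellation it would have to vanish.
    rw [Finset.sum_range_succ'] at h
    ext j
    have hj := congrFun h j
    rw [add_comm] at hj
    have := hadd _ _ hj
    simp only [pow_zero, Matrix.one_mulVec, Nat.sub_zero, Pi.smul_apply, smul_eq_mul] at this
    exact (mul_eq_zero.1 this).resolve_left fun h0 => hρ (eq_zero_of_pow_eq_zero h0)
  · rintro ⟨ρ, ⟨hρ, x, hx0, hx⟩, rfl⟩
    exact ⟨fun h => hρ (eq_zero_of_pow_eq_zero h), x, hx0, eigencone_le_eigencone_pow A ρ _ hx⟩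

theorem eigencone_le_eigenconeSum {B : Matrix (Fin n) (Fin n) R} {ρ : R}
    (hρ : ρ ∈ nonzeroEigenvalues B) : eigencone B ρ ≤ eigenconeSum B :=
  le_iSup₂_of_le ρ hρ le_rfl

theorem exists_finsupp_of_mem_eigenconeSum {B : Matrix (Fin n) (Fin n) R} {x : Fin n → R}
    (hx : x ∈ eigenconeSum B) :
    ∃ f : R →₀ (Fin n → R), (∀ ρ, f ρ ∈ eigencone B ρ) ∧ (∀ ρ, f ρ ≠ 0 → ρ ∈ nonzeroEigenvalues B) ∧
      f.sum (fun _ y => y) = x := by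
  obtain ⟨f, hf, hsum⟩ := (Submodule.mem_iSup_iff_exists_finsupp _ _).1 hx
  refine ⟨f, fun ρ => ?_, fun ρ h => ?_, hsum⟩
  · exact (iSup_le fun _ => le_rfl : _ ≤ eigencone B ρ) (hf ρ)
  · by_contra hρ
    have := hf ρ
    rw [iSup_neg hρ, Submodule.mem_bot] at this
    exact h this

/-- The property of a semiring that the coefficient of `μ ^ t`, `μ ≠ 0`, in an exponential sum which is
itself a multiple of `μ ^ t` is determined by the sum. -/
def ExpSumCoeffUnique (R : Type) [CommSemiring R] : Prop :=
  ∀ (s : Finset R) (c : R → R) (a μ : R), μ ≠ 0 → μ ∈ s →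
    (∀ t : ℕ, μ ^ t * a = ∑ ρ ∈ s, ρ ^ t * c ρ) → a = c μ

theorem eq_component_of_mem_eigencone (hR : ExpSumCoeffUnique R)
    {B : Matrix (Fin n) (Fin n) R} {μ : R} (hμ : μ ≠ 0) {z : Fin n → R} (hz : z ∈ eigencone B μ)
    {f : R →₀ (Fin n → R)} (hf : ∀ ρ, f ρ ∈ eigencone B ρ) (hsum : f.sum (fun _ y => y) = z) :
    z = f μ := by
  classical
  -- Inserting `μ` covers the case `f μ = 0`.
  have hsum' : ∑ ρ ∈ insert μ f.support, f ρ = z := by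
    rw [← hsum]
    exact (Finsupp.sum_of_support_subset f (Finset.subset_insert μ _)
      (fun _ y => y) (by simp)).symm
  ext i
  refine hR (insert μ f.support) (fun ρ => f ρ i) (z i) μ hμ (Finset.mem_insert_self _ _) fun t => ?_
  have h1 : B ^ t *ᵥ z = μ ^ t • z := eigencone_le_eigencone_pow B μ t hz
  have h2 : B ^ t *ᵥ z = ∑ ρ ∈ insert μ f.support, ρ ^ t • f ρ := by
    rw [← hsum', Matrix.mulVec_sum]
    exact Finset.sum_congr rfl fun ρ _ => eigencone_le_eigencone_pow B ρ t (hf ρ)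
  have := congrFun (h1.symm.trans h2) i
  simpa using this

theorem finsupp_sum_eq_add_erase (f : R →₀ (Fin n → R)) (μ : R) :
    ∃ r, f.sum (fun _ y => y) = f μ + r :=
  ⟨_, (Finsupp.add_sum_erase' f μ _ (by simp)).symm⟩

/-- Components of a decomposition of an eigenvector into two elements of the sum of eigencones. -/
theorem exists_components_of_eq_add (hR : ExpSumCoeffUnique R)
    {B : Matrix (Fin n) (Fin n) R} {μ : R} (hμ : μ ≠ 0) {z u v : Fin n → R} (hz : z ∈ eigencone B μ)
    (hu : u ∈ eigenconeSum B) (hv : v ∈ eigenconeSum B) (h : z = u + v) :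
    ∃ u₁ ∈ eigencone B μ, ∃ v₁ ∈ eigencone B μ, ∃ u₂ v₂, u = u₁ + u₂ ∧ v = v₁ + v₂ ∧
      z = u₁ + v₁ := by
  classical
  obtain ⟨f, hf, -, hfu⟩ := exists_finsupp_of_mem_eigenconeSum hu
  obtain ⟨g, hg, -, hgv⟩ := exists_finsupp_of_mem_eigenconeSum hv
  obtain ⟨u₂, hu₂⟩ := finsupp_sum_eq_add_erase f μ
  obtain ⟨v₂, hv₂⟩ := finsupp_sum_eq_add_erase g μ
  refine ⟨f μ, hf μ, g μ, hg μ, u₂, v₂, hfu ▸ hu₂, hgv ▸ hv₂, ?_⟩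
  refine eq_component_of_mem_eigencone hR hμ hz (f := f + g)
    (fun ρ => (eigencone B ρ).add_mem (hf ρ) (hg ρ)) ?_
  rw [Finsupp.sum_add_index' (by simp) (by simp), hfu, hgv, h]

end General

section Nonneg

/-- Distinct `ρ` give distinct characters `t ↦ ρ ^ t` of the monoid `ℕ`, which are linearly
independent by Dedekind. -/
theorem expSumCoeffUnique_nnreal : ExpSumCoeffUnique ℝ≥0 := by
  intro s c a μ _ hμ h
  have hinj : Function.Injective fun ρ : ℝ≥0 => powersHom ℝ (ρ : ℝ) := fun x y hxy =>
    NNReal.coe_injective ((powersHom ℝ).injective hxy)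
  have hli := (linearIndependent_monoidHom (Multiplicative ℕ) ℝ).comp _ hinj
  have key := linearIndependent_iff'.1 hli s
    (fun ρ => (c ρ : ℝ) - if ρ = μ then (a : ℝ) else 0) ?_ μ hμ
  · rw [if_pos rfl, sub_eq_zero] at key
    exact (NNReal.coe_injective key).symm
  · ext t
    have ht : (μ : ℝ) ^ t.toAdd * a = ∑ ρ ∈ s, (ρ : ℝ) ^ t.toAdd * c ρ := by
      exact_mod_cast congrArg NNReal.toReal (h t.toAdd)
    simp only [Finset.sum_apply, Pi.smul_apply, Function.comp_apply, powersHom_apply, smul_eq_mul,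
      sub_mul, Finset.sum_sub_distrib, ite_mul, zero_mul, Finset.sum_ite_eq', hμ, if_true,
      Pi.zero_apply]
    rw [sub_eq_zero, mul_comm (a : ℝ), ht]
    exact Finset.sum_congr rfl fun ρ _ => mul_comm _ _

theorem extremalsNonneg_eigenconeSum {n : ℕ} (B : Matrix (Fin n) (Fin n) ℝ≥0) :
    extremalsNonneg (eigenconeSum B) = ⋃ ρ ∈ nonzeroEigenvalues B, extremalsNonneg (eigencone B ρ) := by
  ext z
  simp only [Set.mem_iUnion, exists_prop]
  constructor
  · rintro ⟨hz, hz0, hext⟩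
    obtain ⟨f, hf, hΛ, hsum⟩ := exists_finsupp_of_mem_eigenconeSum hz
    obtain ⟨ρ, hρ⟩ : ∃ ρ, f ρ ≠ 0 := by
      by_contra! h
      exact hz0 (by rw [← hsum]; exact Finset.sum_eq_zero fun ρ _ => h ρ)
    have hmem : ∀ ρ, f ρ ∈ eigenconeSum B := fun ρ => by
      by_cases h : f ρ = 0
      · rw [h]; exact Submodule.zero_mem _
      · exact eigencone_le_eigenconeSum (hΛ ρ h) (hf ρ)
    obtain ⟨α, hα⟩ := (hext (f ρ) (hmem ρ) ((f.erase ρ).sum fun _ y => y)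
      (Submodule.sum_mem _ fun σ _ => by
        by_cases h : σ = ρ
        · rw [h, Finsupp.erase_same]; exact Submodule.zero_mem _
        · rw [Finsupp.erase_ne h]; exact hmem σ)
      (by rw [← hsum]; exact (Finsupp.add_sum_erase' f ρ _ (by simp)).symm)).1
    have hα0 : α ≠ 0 := fun h => hρ (by rw [hα, h, zero_smul])
    have hzρ : z ∈ eigencone B ρ := by
      have := (eigencone B ρ).smul_mem α⁻¹ (hf ρ)
      rwa [hα, smul_smul, inv_mul_cancel₀ hα0, one_smul] at this
    exact ⟨ρ, hΛ ρ hρ, hzρ, hz0, fun u hu v hv => hext u (eigencone_le_eigenconeSum (hΛ ρ hρ) hu) v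
      (eigencone_le_eigenconeSum (hΛ ρ hρ) hv)⟩
  · rintro ⟨ρ, hρ, hz, hz0, hext⟩
    refine ⟨eigencone_le_eigenconeSum hρ hz, hz0, fun u hu v hv h => ?_⟩
    obtain ⟨u₁, hu₁, v₁, hv₁, u₂, v₂, rfl, rfl, h₁⟩ :=
      exists_components_of_eq_add expSumCoeffUnique_nnreal hρ.1 hz hu hv h
    -- Cancelling `z = u₁ + v₁` leaves no room for other components.
    have h₂ : u₂ + v₂ = 0 := by
      rw [h₁, add_add_add_comm] at h
      exact (left_eq_add.1 h)
    obtain ⟨rfl, rfl⟩ := add_eq_zero.1 h₂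
    rw [add_zero, add_zero]
    exact hext u₁ hu₁ v₁ hv₁ h₁

end Nonneg

section Max

/-- The identity map as a multiplicative isomorphism onto the max algebra. -/
def toMaxMulEquiv : ℝ≥0 ≃* MaxAlg := { toMax with map_mul' := fun _ _ => rfl }

theorem toMax_pow (a : ℝ≥0) (k : ℕ) : toMax (a ^ k) = toMax a ^ k := map_pow toMaxMulEquiv a k

theorem toMax_finset_sup (s : Finset MaxAlg) (g : MaxAlg → ℝ≥0) :
    toMax (s.sup g) = ∑ ρ ∈ s, toMax (g ρ) := by
  classical
  induction s using Finset.induction_on with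
  | empty => rfl
  | insert ρ s hρ ih => rw [Finset.sum_insert hρ, Finset.sup_insert, ← ih]; rfl

instance : NoZeroDivisors MaxAlg where
  eq_zero_or_eq_zero_of_mul_eq_zero {a b} h := mul_eq_zero (M₀ := ℝ≥0) (a := a) (b := b) |>.1 h

theorem MaxAlg.add_self (a : MaxAlg) : a + a = a := max_self (α := ℝ≥0) a

theorem MaxAlg.eq_zero_of_add_eq_zero (a b : MaxAlg) (h : a + b = 0) : a = 0 := by
  have h' : max (toMax.symm a) (toMax.symm b) = 0 := h
  have h₀ : toMax.symm a = 0 := le_antisymm (h' ▸ le_max_left _ _) zero_le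
  exact h₀

theorem eventually_pow_mul_lt_pow_mul {ρ μ c a : ℝ≥0} (h : ρ < μ) (ha : 0 < a) :
    ∀ᶠ t : ℕ in Filter.atTop, ρ ^ t * c < μ ^ t * a := by
  have hμ : 0 < μ := h.bot_lt
  have hlim : Filter.Tendsto (fun t : ℕ => (ρ / μ) ^ t * c) Filter.atTop (nhds (0 * c)) :=
    (tendsto_pow_atTop_nhds_zero_of_lt_one (zero_le) ((div_lt_one hμ).2 h)).mul_const c
  rw [zero_mul] at hlim
  filter_upwards [hlim.eventually_lt_const ha] with t ht
  rw [div_pow, div_mul_eq_mul_div, div_lt_iff₀ (pow_pos hμ t)] at ht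
  rwa [mul_comm (μ ^ t)]

/-- Growth rates replace linear independence: if the coefficient at `μ` were below `a`, every term
would eventually be strictly below `μ ^ t * a`, and so would their finite maximum. -/
theorem expSumCoeffUnique_max : ExpSumCoeffUnique MaxAlg := by
  intro s c a μ hμ₀ hμ h
  obtain ⟨a, rfl⟩ := toMax.surjective a
  have hμ0 : 0 < toMax.symm μ := pos_iff_ne_zero.2 hμ₀
  have hsup : ∀ t : ℕ, (toMax.symm μ) ^ t * a =
      s.sup fun ρ => (toMax.symm ρ) ^ t * toMax.symm (c ρ) := by
    intro t
    apply toMax.injective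
    rw [toMax_finset_sup]
    simpa only [← toMax_mul, toMax_pow, Equiv.apply_symm_apply] using h t
  have hle : ∀ ρ ∈ s, ∀ t : ℕ, (toMax.symm ρ) ^ t * toMax.symm (c ρ) ≤ (toMax.symm μ) ^ t * a :=
    fun ρ hρ t => (Finset.le_sup (f := fun ρ => (toMax.symm ρ) ^ t * toMax.symm (c ρ)) hρ).trans_eq
      (hsup t).symm
  suffices a = toMax.symm (c μ) by rw [this, Equiv.apply_symm_apply]
  by_contra hne
  have hlt : toMax.symm (c μ) < a :=
    lt_of_le_of_ne (by simpa using hle μ hμ 0) (Ne.symm hne)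
  have ha : 0 < a := hlt.bot_lt
  have hev : ∀ ρ ∈ s, ∀ᶠ t : ℕ in Filter.atTop,
      (toMax.symm ρ) ^ t * toMax.symm (c ρ) < (toMax.symm μ) ^ t * a := by
    intro ρ hρ
    rcases lt_trichotomy (toMax.symm ρ) (toMax.symm μ) with hlt' | heq | hgt
    · exact eventually_pow_mul_lt_pow_mul hlt' ha
    · obtain rfl := toMax.symm.injective heq
      exact Filter.Eventually.of_forall fun t =>
        mul_lt_mul_of_pos_left hlt (pow_pos hμ0 t)
    -- A nonzero term with `ρ > μ` would outgrow the total.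
    · have hc : toMax.symm (c ρ) = 0 := by
        by_contra hc
        obtain ⟨t, ht⟩ := (eventually_pow_mul_lt_pow_mul (c := a) hgt (pos_iff_ne_zero.2 hc)).exists
        exact (hle ρ hρ t).not_gt ht
      exact Filter.Eventually.of_forall fun t => by
        rw [hc, mul_zero]
        exact mul_pos (pow_pos hμ0 t) ha
  obtain ⟨t, ht⟩ := ((Filter.eventually_all_finset s).2 hev).exists
  refine (hsup t).not_gt ((Finset.sup_lt_iff ?_).2 ht)
  exact mul_pos (pow_pos hμ0 t) ha

theorem exists_eq_of_eq_sum {n : ℕ} {V : Submodule MaxAlg (Fin n → MaxAlg)} {z : Fin n → MaxAlg}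
    (hz : z ∈ extremalsMax V) {ι : Type*} (s : Finset ι) (f : ι → Fin n → MaxAlg)
    (hf : ∀ i ∈ s, f i ∈ V) (h : z = ∑ i ∈ s, f i) : ∃ i ∈ s, z = f i := by
  classical
  induction s using Finset.induction_on with
  | empty => exact absurd h hz.2.1
  | insert i s hi ih =>
    rw [Finset.sum_insert hi] at h
    have hf' : ∀ j ∈ s, f j ∈ V := fun j hj => hf j (Finset.mem_insert_of_mem hj)
    rcases hz.2.2 _ (hf i (Finset.mem_insert_self i s)) _ (V.sum_mem hf') h with h | h
    · exact ⟨i, Finset.mem_insert_self i s, h⟩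
    · obtain ⟨j, hj, hjz⟩ := ih hf' h
      exact ⟨j, Finset.mem_insert_of_mem hj, hjz⟩

/-- In the coordinatewise order the hypotheses say `u ≤ z` and `z ≤ u`; the calculation uses only
idempotency of addition. -/
theorem eq_add_of_eq_add_of_component {n : ℕ} {z u v r : Fin n → MaxAlg} (h : z = u + v)
    (hu : u = z + r) : z = u := by
  have hself : ∀ x : Fin n → MaxAlg, x + x = x := fun x => funext fun i => MaxAlg.add_self (x i)
  calc z = u + v := h
    _ = u + u + v := by rw [hself]
    _ = u + z := by rw [add_assoc, ← h]
    _ = z + z + r := by rw [hu]; abel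
    _ = u := by rw [hself, ← hu]

theorem extremalsMax_eigenconeSum {n : ℕ} (B : Matrix (Fin n) (Fin n) MaxAlg) :
    extremalsMax (eigenconeSum B) = ⋃ ρ ∈ nonzeroEigenvalues B, extremalsMax (eigencone B ρ) := by
  ext z
  simp only [Set.mem_iUnion, exists_prop]
  constructor
  · intro hz
    obtain ⟨f, hf, hΛ, hsum⟩ := exists_finsupp_of_mem_eigenconeSum hz.1
    obtain ⟨ρ, hρ, rfl⟩ := exists_eq_of_eq_sum hz f.support f
      (fun ρ hρ => eigencone_le_eigenconeSum (hΛ ρ (Finsupp.mem_support_iff.1 hρ)) (hf ρ)) hsum.symm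
    have hρ' := hΛ ρ hz.2.1
    exact ⟨ρ, hρ', hf ρ, hz.2.1, fun u hu v hv => hz.2.2 u (eigencone_le_eigenconeSum hρ' hu) v
      (eigencone_le_eigenconeSum hρ' hv)⟩
  · rintro ⟨ρ, hρ, hz, hz0, hext⟩
    refine ⟨eigencone_le_eigenconeSum hρ hz, hz0, fun u hu v hv h => ?_⟩
    obtain ⟨u₁, hu₁, v₁, hv₁, u₂, v₂, hu₂, hv₂, h₁⟩ :=
      exists_components_of_eq_add expSumCoeffUnique_max hρ.1 hz hu hv h
    rcases hext u₁ hu₁ v₁ hv₁ h₁ with rfl | rfl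
    · exact Or.inl (eq_add_of_eq_add_of_component h hu₂)
    · exact Or.inr (eq_add_of_eq_add_of_component (h.trans (add_comm u v)) hv₂)

end Max

theorem NNReal.exists_pow_succ_eq (k : ℕ) (μ : ℝ≥0) : ∃ ρ : ℝ≥0, ρ ^ (k + 1) = μ :=
  ⟨μ ^ (((k + 1 : ℕ) : ℝ)⁻¹), NNReal.rpow_inv_natCast_pow μ k.succ_ne_zero⟩

theorem proposition5p1 (n : ℕ) (A : Matrix (Fin n) (Fin n) ℝ≥0) (k : ℕ) (hk : 1 ≤ k) :
    (extremalsNonneg (eigenconeSum (A ^ k)) =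
      ⋃ ρ ∈ nonzeroEigenvalues A, extremalsNonneg (eigencone (A ^ k) (ρ ^ k))) ∧
    (extremalsMax (eigenconeSum ((A.map toMax) ^ k)) =
      ⋃ ρ ∈ nonzeroEigenvalues (A.map toMax),
        extremalsMax (eigencone ((A.map toMax) ^ k) (ρ ^ k))) := by
  obtain ⟨k, rfl⟩ := Nat.exists_eq_succ_of_ne_zero (Nat.one_le_iff_ne_zero.1 hk)
  constructor
  · rw [extremalsNonneg_eigenconeSum, nonzeroEigenvalues_pow (fun a b h => (add_eq_zero.1 h).1) k
      (NNReal.exists_pow_succ_eq k), Set.biUnion_image]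
  · rw [extremalsMax_eigenconeSum, nonzeroEigenvalues_pow MaxAlg.eq_zero_of_add_eq_zero k
      (fun μ => ?_), Set.biUnion_image]
    obtain ⟨ρ, hρ⟩ := NNReal.exists_pow_succ_eq k (toMax.symm μ)
    exact ⟨toMax ρ, by rw [← toMax_pow, hρ, Equiv.apply_symm_apply]⟩
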